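/- Let $d\ge 1$, let $\mathsf X\in\mathcal B(\mathbb R^d)$ carry the trace $\mathcal X$ of the Borel $\sigma$-field, and let $\bar\gamma>0$. Let $\Pi:\mathbb R^d\to\mathsf X$ be measurable and, for each $\gamma\in(0,\bar\gamma]$, let $\mathcal T_\gamma:\mathsf X\to\mathbb R^d$ be measurable. Let $\mathrm R_\gamma$ be the Markov kernel on $\mathsf X$ of the recursion $X_{k+1}=\Pi(\mathcal T_\gamma(X_k)+\sqrt\gamma\,Z_{k+1})$ with $(Z_k)_{k\ge1}$ i.i.d. standard Gaussian in $\mathbb R^d$. Write $\Delta_{\mathsf X}=\{(x,x):x\in\mathsf X\}$ and $\Delta_{\mathsf X,M}=\{(x,y)\in\mathsf X^2:\|x-y\|\le M\}$. For probability measures $\mu,\nu$ on $\mathsf X$ and a measurable cost $\mathbf c\ge 0$ on $\mathsf X^2$ let $\mathbf W_{\mathbf c}(\mu,\nu)=\inf_\zeta\int\mathbf c\,d\zeta$, the infimum being over all couplings $\zeta$ of $\mu$ and $\nu$. **Assumptions.** There are $\lambda\in(0,1)$, $A\ge0$, $\tilde M>0$, a measurable $\mathcal V:\mathsf X^2\to[1,\infty)$,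 a set $\mathbf C\in\mathcal X^{\otimes2}$ with $\mathbf C\subset\Delta_{\mathsf X,\tilde M}$ and, for each $\gamma\in(0,\bar\gamma]$, a Markov kernel $\tilde{\mathrm K}_\gamma$ on $\mathsf X^2$ such that $\tilde{\mathrm K}_\gamma((x,y),\cdot)$ is a coupling of $\mathrm R_\gamma(x,\cdot)$ and $\mathrm R_\gamma(y,\cdot)$ for all $x,y\in\mathsf X$, with the following properties. * (Drift) $\tilde{\mathrm K}_\gamma\mathcal V\le\lambda^\gamma\mathcal V+A\gamma\mathbb 1_{\mathbf C}$ on $\mathsf X^2$. * (Absorption) $\tilde{\mathrm K}_\gamma((x,x),\Delta_{\mathsf X})=1$ for all $x\in\mathsf X$. * (Minorization) There is $\Psi:(0,\bar\gamma]\times\mathbb N^*\times\mathbb R_+\to[0,1]$ such that for all $\gamma\in(0,\bar\gamma]$, $\ell\in\mathbb N^*$ and $x,y\in\mathsf X$, $\tilde{\mathrm K}_\gamma^{\ell\lceil1/\gamma\rceil}((x,y),\Delta_{\mathsf X}^c)\le1-\Psi(\gamma,\ell,\|x-y\|)$, and $\inf_{(x,y)\in\Delta_{\mathsf X,M}}\Psi(\gamma,\ell,\|x-y\|)>0$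 for every $M\ge0$. Let $\mathbf c(x,y)=\mathbb 1_{x\ne y}\mathcal V(x,y)$. **Then**, for all $\gamma\in(0,\bar\gamma]$, $k\in\mathbb N$ and $x,y\in\mathsf X$, $$\mathbf W_{\mathbf c}(\delta_x\mathrm R_\gamma^k,\delta_y\mathrm R_\gamma^k)\le\tilde{\mathrm K}_\gamma^k\mathbf c(x,y).$$ Moreover let $\ell\in\mathbb N^*$ and put $\bar B=\sup_{(x,y)\in\mathbf C}\mathcal V(x,y)$ and $\bar\varepsilon=\inf_{\gamma\in(0,\bar\gamma],\,(x,y)\in\Delta_{\mathsf X,\tilde M}}\Psi(\gamma,\ell,\|x-y\|)$. If $\bar B<\infty$ and $\bar\varepsilon>0$, then for all $\gamma\in(0,\bar\gamma]$, $k\in\mathbb N$ and $x,y\in\mathsf X$, $$\tilde{\mathrm K}_\gamma^k\mathbf c(x,y)\le\lambda^{k\gamma/4}\left[\bar D_1\mathbf c(x,y)+\bar D_2\mathbb 1_{x\ne y}\right]+\bar C_1\bar\rho_1^{\,k\gamma/4}\mathbb 1_{x\ne y},$$ where $$\bar D_1=1+\frac{4A\log^{-1}(1/\lambda)}{\lambda^{\bar\gamma}},\qquad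 \bar D_2=\bar D_1A\lambda^{-(1+\bar\gamma)\ell}(1+\bar\gamma)\ell,\qquad \bar C_1=\frac{8A\log^{-1}(1/\bar\rho_1)}{\bar\rho_1^{\,\bar\gamma}},$$ $$\log\bar\rho_1=\frac{\log(\lambda)\log(1-\bar\varepsilon)}{-\log(\bar c_1)+\log(1-\bar\varepsilon)},\qquad \bar c_1=\bar B+A\lambda^{-(1+\bar\gamma)\ell}(1+\bar\gamma)\ell$$ (with $\log\bar\rho_1=\log\lambda$, the limiting value, if $\bar\varepsilon=1$). If in addition $\bar\gamma\le1$ and $\bar\varepsilon\le1-e^{-1}$, then $$\log^{-1}(\bar\rho_1^{-1})\le\frac{1+\log\bar B+\log(1+2A\ell)+2\ell\log(\lambda^{-1})}{\log(\lambda^{-1})\,\bar\varepsilon}.$$ -/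

import Mathlib

open MeasureTheory ProbabilityTheory Set
open scoped ENNReal

noncomputable section

namespace FunctionalAR

/-- The Markov kernel on `X` of the recursion `X' = Π (T X + √γ Z)`, where `Z` is a standard
Gaussian vector of `ℝ^d`; here `S` is the map `Π : ℝ^d → X` and `T = T_γ : X → ℝ^d`. -/
def arKernel {d : ℕ} {X : Set (EuclideanSpace ℝ (Fin d))}
    (S : EuclideanSpace ℝ (Fin d) → X) (T : X → EuclideanSpace ℝ (Fin d)) (γ : ℝ) :
    Kernel X X :=
  ((Kernel.id : Kernel X X) ×ₖ
      Kernel.const X (stdGaussian (EuclideanSpace ℝ (Fin d)))).map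
    (fun p => S (T p.1 + √γ • p.2))

/-- `arKernel S T γ x` is the law of `S (T x + √γ Z)`, for `Z` standard Gaussian. -/
theorem arKernel_apply {d : ℕ} {X : Set (EuclideanSpace ℝ (Fin d))}
    {S : EuclideanSpace ℝ (Fin d) → X} {T : X → EuclideanSpace ℝ (Fin d)}
    (hS : Measurable S) (hT : Measurable T) (γ : ℝ) (x : X) :
    arKernel S T γ x =
      (stdGaussian (EuclideanSpace ℝ (Fin d))).map (fun z => S (T x + √γ • z)) := by
  have h : Measurable (fun p : X × EuclideanSpace ℝ (Fin d) => S (T p.1 + √γ • p.2)) :=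
    hS.comp ((hT.comp measurable_fst).add (by fun_prop))
  rw [arKernel, Kernel.map_apply _ h, Kernel.prod_apply, Kernel.id_apply, Kernel.const_apply,
    Measure.dirac_prod, Measure.map_map h (by fun_prop)]
  rfl

/-- `ζ` is a transference plan (coupling) between `μ` and `ν`. -/
structure IsTransferencePlan {Y : Type*} [MeasurableSpace Y]
    (ζ : Measure (Y × Y)) (μ ν : Measure Y) : Prop where
  isProbabilityMeasure : IsProbabilityMeasure ζ
  map_fst : ζ.map Prod.fst = μ
  map_snd : ζ.map Prod.snd = ν

/-- The Wasserstein cost `W_c(μ, ν)`: infimum of `∫ c dζ` over all transference plans `ζ`. -/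
def wassersteinCost {Y : Type*} [MeasurableSpace Y] (c : Y × Y → ℝ) (μ ν : Measure Y) : ℝ≥0∞ :=
  ⨅ (ζ : Measure (Y × Y)) (_ : IsTransferencePlan ζ μ ν), ∫⁻ p, ENNReal.ofReal (c p) ∂ζ

/-- `K` is a Markov coupling kernel for `R`. -/
structure IsMarkovCoupling {Y : Type*} [MeasurableSpace Y]
    (K : Kernel (Y × Y) (Y × Y)) (R : Kernel Y Y) : Prop where
  isMarkovKernel : IsMarkovKernel K
  plan : ∀ p : Y × Y, IsTransferencePlan (K p) (R p.1) (R p.2)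

/-- The discrete Foster-Lyapunov drift condition `D_d(V, lam, A, C)`:
`K V ≤ lam V + A 1_C` pointwise. -/
def DriftCondition {Y : Type*} [MeasurableSpace Y]
    (K : Kernel Y Y) (V : Y → ℝ) (lam A : ℝ) (C : Set Y) : Prop :=
  ∀ y, ∫⁻ z, ENNReal.ofReal (V z) ∂(K y)
    ≤ ENNReal.ofReal (lam * V y + A * C.indicator (fun _ => (1 : ℝ)) y)

/-- The indicator `1_{x ≠ y}` of the complement of the diagonal. -/
def offDiag {Y : Type*} : Y × Y → ℝ := (diagonal Y)ᶜ.indicator (fun _ => 1)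

/-- The cost `c(x, y) = 1_{x ≠ y} V(x, y)`. -/
def cost {Y : Type*} (V : Y × Y → ℝ) : Y × Y → ℝ := fun p => offDiag p * V p

/-- `Δ_{X,M} = {(x, y) ∈ X × X : ‖x - y‖ ≤ M}`. -/
def closePairs {d : ℕ} (X : Set (EuclideanSpace ℝ (Fin d))) (M : ℝ) : Set (X × X) :=
  {p | ‖(p.1 : EuclideanSpace ℝ (Fin d)) - p.2‖ ≤ M}

/-- `B = sup_{(x, y) ∈ C} V(x, y)`. -/
def supB {Y : Type*} (V : Y × Y → ℝ) (C : Set (Y × Y)) : ℝ := sSup (V '' C)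

/-- `ε = inf {Ψ(γ, ℓ, ‖x - y‖) : γ ∈ (0, γbar], (x, y) ∈ Δ_{X,M}}`. -/
def epsBar {d : ℕ} (X : Set (EuclideanSpace ℝ (Fin d))) (Ψ : ℝ → ℕ → ℝ → ℝ)
    (γbar M : ℝ) (l : ℕ) : ℝ :=
  sInf {r | ∃ γ ∈ Ioc 0 γbar, ∃ p ∈ closePairs X M,
    r = Ψ γ l ‖(p.1 : EuclideanSpace ℝ (Fin d)) - p.2‖}

/-- `A lam^{-(1+γbar)ℓ} (1+γbar) ℓ`, the term shared by `D₂` and `c₁`. -/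
def growth (lam A γbar : ℝ) (l : ℕ) : ℝ :=
  A * lam ^ (-((1 + γbar) * l)) * (1 + γbar) * l

/-- `c₁ = B + A lam^{-(1+γbar)ℓ} (1+γbar) ℓ`. -/
def constc (B lam A γbar : ℝ) (l : ℕ) : ℝ := B + growth lam A γbar l

/-- `log ρ₁ = log lam · log (1 - ε) / (-log c₁ + log (1 - ε))`. For `ε = 1`, where
`log (1 - ε) = -∞`, the quotient is read as its limit `log lam`. -/
def logRho (lam ε c : ℝ) : ℝ :=
  if ε = 1 then Real.log lam
  else Real.log lam * Real.log (1 - ε) / (-Real.log c + Real.log (1 - ε))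

/-- `D₁ = 1 + 4 A log⁻¹(1/lam) / lam^γbar`. -/
def constD₁ (lam A γbar : ℝ) : ℝ := 1 + 4 * A * (Real.log (1 / lam))⁻¹ / lam ^ γbar

/-- `D₂ = D₁ A lam^{-(1+γbar)ℓ} (1+γbar) ℓ`. -/
def constD₂ (lam A γbar : ℝ) (l : ℕ) : ℝ := constD₁ lam A γbar * growth lam A γbar l

/-- `C₁ = 8 A log⁻¹(1/ρ) / ρ^γbar`. -/
def constC₁ (ρ A γbar : ℝ) : ℝ := 8 * A * (Real.log (1 / ρ))⁻¹ / ρ ^ γbar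

end FunctionalAR

end

/-!
The iterates of the coupling kernel `K` of `R` couple the iterates of `R`, which gives the bound on
the Wasserstein cost. For the decay of `K ^ k c`, write `N` for the complement of the diagonal,
`a k p = (K ^ k) p N` for the probability that the coupling has not succeeded by time `k`, and
`n = l ⌈1 / γ⌉`.

Since the diagonal is absorbing, `K ^ (k + 1) c ≤ lam ^ γ K ^ k c + A γ a k`
(`lintegral_indicator_pow_succ_le`), so that everything reduces to bounding `a k`. From a point of
`C`, the pair coalesces within `n` steps with probability at least `ε`, while
`K ^ n V ≤ lam ^ (n γ) c₁`. Hölder's inequality with the exponent `s` for which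
`(1 - ε) ^ (1 - s) c₁ ^ s = 1` shows that `∫ 1_N V ^ s dK ^ n ≤ lam ^ (s n γ)` on `C`
(`DriftCondition.setLIntegral_rpow_pow_le`), and `lam ^ s` is precisely `ρ`. Off `C`, Jensen's
inequality gives `K (V ^ s) ≤ ρ ^ γ V ^ s`. An induction on `k`, with jumps of `n` steps from `C` and
single steps elsewhere, yields `a k ≤ ρ ^ (k γ - n γ) V ^ s` (`pow_apply_mul_le_of_contraction`).

The factor `lam ^ (-n γ)` is at most `V + growth` because `1 ≤ K ^ n V`
(`DriftCondition.rpow_neg_le`). Distinguishing whether `(V + growth) lam ^ (k γ / 4)` exceeds `1`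
separates the starting point from the rate: `a k ≤ (V + growth) lam ^ (k γ / 4) + ρ ^ (k γ / 2)`
(`survival_le_add`). The linear recursion for `K ^ k c` is then solved by `recursion_le`, and the
constants `D₁` and `C₁` come from `mul_le_const_mul_rpow_sub`.
-/

namespace FunctionalAR

/-! ### Iterates of a kernel with an absorbing set -/

section Kernel

variable {Y : Type*} [MeasurableSpace Y] {κ : Kernel Y Y}

theorem lintegral_pow_succ_apply (κ : Kernel Y Y) (k : ℕ) (y : Y) {f : Y → ℝ≥0∞}
    (hf : Measurable f) :
    ∫⁻ z, f z ∂(κ ^ (k + 1)) y = ∫⁻ z, ∫⁻ w, f w ∂κ z ∂(κ ^ k) y := by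
  rw [add_comm, Kernel.pow_add, Kernel.lintegral_comp _ _ _ hf, pow_one]

theorem isMarkovKernel_pow (κ : Kernel Y Y) [IsMarkovKernel κ] (k : ℕ) :
    IsMarkovKernel (κ ^ k) := by
  induction k with
  | zero => rw [pow_zero]; exact inferInstanceAs (IsMarkovKernel Kernel.id)
  | succ k ih => rw [Kernel.pow_add, pow_one]; infer_instance

/-- Once a Markov chain has left `N` it never returns, if the complement of `N` is absorbing. -/
theorem pow_apply_eq_zero_of_notMem {N : Set Y} (hN : MeasurableSet N)
    (habs : ∀ y ∉ N, κ y N = 0) (k : ℕ) {y : Y} (hy : y ∉ N) : (κ ^ k) y N = 0 := by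
  induction k generalizing y with
  | zero =>
    change Kernel.id y N = 0
    rw [Kernel.id_apply, Measure.dirac_apply' _ hN, indicator_of_notMem hy]
  | succ k ih =>
    rw [add_comm, Kernel.pow_add_apply_eq_lintegral _ _ _ _ hN, pow_one,
      lintegral_eq_zero_iff ((κ ^ k).measurable_coe hN)]
    have h : ∀ᵐ z ∂κ y, z ∉ N := measure_eq_zero_iff_ae_notMem.1 (habs y hy)
    filter_upwards [h] with z hz using ih hz

/-- Iterating a drift inequality with contraction factor `a ≤ 1` and additive constant `b`. -/
theorem lintegral_pow_le_of_drift {v : Y → ℝ≥0∞} (hv : Measurable v) {a b : ℝ≥0∞} (ha : a ≤ 1)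
    [IsMarkovKernel κ] (h : ∀ y, ∫⁻ z, v z ∂κ y ≤ a * v y + b) (k : ℕ) (y : Y) :
    ∫⁻ z, v z ∂(κ ^ k) y ≤ a ^ k * v y + k * b := by
  induction k with
  | zero =>
    change ∫⁻ z, v z ∂Kernel.id y ≤ _
    simp [Kernel.id_apply, lintegral_dirac' _ hv]
  | succ k ih =>
    have := isMarkovKernel_pow κ k
    rw [lintegral_pow_succ_apply _ _ _ hv]
    calc ∫⁻ z, ∫⁻ w, v w ∂κ z ∂(κ ^ k) y
        ≤ ∫⁻ z, (a * v z + b) ∂(κ ^ k) y := lintegral_mono h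
      _ = a * ∫⁻ z, v z ∂(κ ^ k) y + b := by
          rw [lintegral_add_right _ measurable_const, lintegral_const_mul _ hv]; simp
      _ ≤ a * (a ^ k * v y + k * b) + b := by gcongr
      _ = a ^ (k + 1) * v y + (a * (k * b) + b) := by ring
      _ ≤ a ^ (k + 1) * v y + (1 * (k * b) + b) := by gcongr
      _ = _ := by push_cast; ring

/-- Geometric decay of the probability of still being in `N` at time `k`. Outside `C` the function
`v ^ s` contracts by `a ^ s` in one step; from `C` the chain is run for `n` steps, during which the
part of the mass that has been absorbed compensates the growth of `v ^ s`. -/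
theorem pow_apply_mul_le_of_contraction {N C : Set Y} (hN : MeasurableSet N)
    (habs : ∀ y ∉ N, κ y N = 0) [IsMarkovKernel κ] {v : Y → ℝ≥0∞} (hv : Measurable v)
    (hv1 : ∀ y, 1 ≤ v y) {a : ℝ≥0∞} (ha : a ≤ 1) {s : ℝ} (hs0 : 0 < s) (hs1 : s ≤ 1)
    {n : ℕ} (hn : 1 ≤ n) (hout : ∀ y ∉ C, ∫⁻ z, v z ∂κ y ≤ a * v y)
    (hin : ∀ y ∈ C, ∫⁻ z in N, v z ^ s ∂(κ ^ n) y ≤ (a ^ s) ^ n) (k : ℕ) (y : Y) :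
    (κ ^ k) y N * (a ^ s) ^ n ≤ (a ^ s) ^ k * v y ^ s := by
  have hr : a ^ s ≤ 1 := ENNReal.rpow_le_one ha hs0.le
  have hvs : ∀ y, 1 ≤ v y ^ s := fun y => ENNReal.one_le_rpow (hv1 y) hs0
  induction k using Nat.strong_induction_on generalizing y with
  | _ k ih =>
  rcases le_or_gt k n with hkn | hkn
  · have := isMarkovKernel_pow κ k
    calc (κ ^ k) y N * (a ^ s) ^ n ≤ 1 * (a ^ s) ^ k :=
          mul_le_mul' prob_le_one (pow_le_pow_right_of_le_one' hr hkn)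
      _ = (a ^ s) ^ k * 1 := mul_comm _ _
      _ ≤ _ := by gcongr; exact hvs y
  by_cases hy : y ∈ C
  · obtain ⟨j, rfl⟩ := Nat.exists_eq_add_of_lt hkn
    have hj : n + j + 1 = (j + 1) + n := by ring
    rw [hj, add_comm (j + 1) n, Kernel.pow_add_apply_eq_lintegral _ _ _ _ hN,
      ← lintegral_mul_const _ (Kernel.measurable_coe _ hN)]
    calc ∫⁻ z, (κ ^ (j + 1)) z N * (a ^ s) ^ n ∂(κ ^ n) y
        ≤ ∫⁻ z, N.indicator (fun z => (a ^ s) ^ (j + 1) * v z ^ s) z ∂(κ ^ n) y := by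
          refine lintegral_mono fun z => ?_
          by_cases hz : z ∈ N
          · rw [indicator_of_mem hz]
            exact ih _ (by omega) z
          · simp [pow_apply_eq_zero_of_notMem hN habs _ hz]
      _ = (a ^ s) ^ (j + 1) * ∫⁻ z in N, v z ^ s ∂(κ ^ n) y := by
          rw [lintegral_indicator hN, lintegral_const_mul _ (hv.pow_const s)]
      _ ≤ (a ^ s) ^ (j + 1) * (a ^ s) ^ n := by gcongr; exact hin y hy
      _ = (a ^ s) ^ (n + (j + 1)) * 1 := by rw [mul_one, pow_add]; ring
      _ ≤ _ := by gcongr; exact hvs y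
  · obtain ⟨j, rfl⟩ : ∃ j, k = j + 1 := ⟨k - 1, by omega⟩
    have jensen : ∫⁻ z, v z ^ s ∂κ y ≤ (∫⁻ z, v z ∂κ y) ^ s := by
      have := ENNReal.lintegral_mul_norm_pow_le (μ := κ y) (f := v) (g := fun _ => 1)
        hv.aemeasurable aemeasurable_const hs0.le (sub_nonneg.2 hs1) (by ring)
      simpa using this
    rw [add_comm j, Kernel.pow_add_apply_eq_lintegral _ _ _ _ hN, pow_one,
      ← lintegral_mul_const _ (Kernel.measurable_coe _ hN)]
    calc ∫⁻ z, (κ ^ j) z N * (a ^ s) ^ n ∂κ y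
        ≤ ∫⁻ z, (a ^ s) ^ j * v z ^ s ∂κ y :=
          lintegral_mono fun z => ih j (by omega) z
      _ = (a ^ s) ^ j * ∫⁻ z, v z ^ s ∂κ y := lintegral_const_mul _ (hv.pow_const s)
      _ ≤ (a ^ s) ^ j * (a * v y) ^ s := by
          gcongr
          exact jensen.trans (ENNReal.rpow_le_rpow (hout y hy) hs0.le)
      _ = _ := by rw [ENNReal.mul_rpow_of_nonneg _ _ hs0.le]; ring

/-- The drift of `1_N v`, where the additive term is only paid while the chain is in `N`. -/
theorem lintegral_indicator_pow_succ_le {N : Set Y} (hN : MeasurableSet N)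
    (habs : ∀ y ∉ N, κ y N = 0) {v : Y → ℝ≥0∞} (hv : Measurable v) {a b : ℝ≥0∞}
    (h : ∀ y, ∫⁻ z, v z ∂κ y ≤ a * v y + b) (k : ℕ) (y : Y) :
    ∫⁻ z, N.indicator v z ∂(κ ^ (k + 1)) y
      ≤ a * ∫⁻ z, N.indicator v z ∂(κ ^ k) y + b * (κ ^ k) y N := by
  have hm := hv.indicator hN
  rw [lintegral_pow_succ_apply _ _ _ hm, ← lintegral_const_mul _ hm, ← setLIntegral_const,
    ← lintegral_indicator hN, ← lintegral_add_left (hm.const_mul a)]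
  refine lintegral_mono fun z => ?_
  by_cases hz : z ∈ N
  · simp only [indicator_of_mem hz]
    exact (lintegral_mono (indicator_le_self N v)).trans (h z)
  · simp only [indicator_of_notMem hz, lintegral_indicator hN, mul_zero, add_zero]
    rw [setLIntegral_measure_zero _ _ (habs z hz)]

/-- Hölder's inequality for a power of `v` restricted to an event `N`. -/
theorem setLIntegral_rpow_le {μ : Measure Y} (N : Set Y)
    {v : Y → ℝ≥0∞} (hv : Measurable v) {s : ℝ} (hs0 : 0 ≤ s) (hs1 : s ≤ 1) :
    ∫⁻ z in N, v z ^ s ∂μ ≤ (μ N) ^ (1 - s) * (∫⁻ z, v z ∂μ) ^ s := by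
  have h := ENNReal.lintegral_mul_norm_pow_le (μ := μ.restrict N) (f := fun _ => 1) (g := v)
    aemeasurable_const hv.aemeasurable (sub_nonneg.2 hs1) hs0 (by ring)
  simp only [ENNReal.one_rpow, one_mul, lintegral_const, Measure.restrict_apply_univ] at h
  refine h.trans ?_
  gcongr
  exact Measure.restrict_le_self

/-- The iterates of a Markov coupling of `R` couple the iterates of `R`. -/
theorem IsMarkovCoupling.isTransferencePlan_pow {K : Kernel (Y × Y) (Y × Y)} {R : Kernel Y Y}
    (hK : IsMarkovCoupling K R) (k : ℕ) (p : Y × Y) :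
    IsTransferencePlan ((K ^ k) p) ((R ^ k) p.1) ((R ^ k) p.2) := by
  have := hK.isMarkovKernel
  have hprob := isMarkovKernel_pow K k
  suffices h : ((K ^ k) p).map Prod.fst = (R ^ k) p.1 ∧ ((K ^ k) p).map Prod.snd = (R ^ k) p.2 from
    ⟨hprob.isProbabilityMeasure p, h.1, h.2⟩
  clear hprob
  induction k with
  | zero =>
    change (Kernel.id p).map Prod.fst = Kernel.id p.1 ∧ (Kernel.id p).map Prod.snd = Kernel.id p.2
    simp only [Kernel.id_apply]
    exact ⟨Measure.map_dirac' measurable_fst _, Measure.map_dirac' measurable_snd _⟩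
  | succ k ih =>
    have key : ∀ π : Y × Y → Y, Measurable π → (∀ q, (K q).map π = R (π q)) →
        ((K ^ k) p).map π = (R ^ k) (π p) → ((K ^ (k + 1)) p).map π = (R ^ (k + 1)) (π p) := by
      intro π hπ hq hk
      ext t ht
      rw [Measure.map_apply hπ ht, Kernel.pow_add_apply_eq_lintegral _ _ _ _ (hπ ht),
        Kernel.pow_add_apply_eq_lintegral _ _ _ _ ht, pow_one, pow_one, ← hk,
        lintegral_map (Kernel.measurable_coe _ ht) hπ]
      refine lintegral_congr fun q => ?_
      rw [← hq, Measure.map_apply hπ ht]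
    exact ⟨key _ measurable_fst (fun q => (hK.plan q).map_fst) ih.1,
      key _ measurable_snd (fun q => (hK.plan q).map_snd) ih.2⟩

end Kernel

/-! ### Estimates for the constants and for linear recursions -/

section Constants

/-- The rate `ρ` is `lam ^ s` for the exponent `s ∈ (0, 1]` at which the Hölder interpolation
between the growth `c` of a cycle and its failure probability `1 - ε` is exactly `1`. For `ε = 1`
the exponent is `1` and no interpolation is needed. -/
theorem exists_logRho_eq {lam ε c : ℝ} (hε0 : 0 < ε) (hε1 : ε ≤ 1) (hc : 1 ≤ c) :
    ∃ s : ℝ, 0 < s ∧ s ≤ 1 ∧ logRho lam ε c = Real.log lam * s ∧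
      (ε ≠ 1 → (1 - ε) ^ (1 - s) * c ^ s = 1) := by
  rcases eq_or_ne ε 1 with h | h
  · exact ⟨1, one_pos, le_rfl, by simp [logRho, h], fun h' => absurd h h'⟩
  have hlt : ε < 1 := lt_of_le_of_ne hε1 h
  have hL : Real.log (1 - ε) < 0 := Real.log_neg (by linarith) (by linarith)
  have hc0 : 0 ≤ Real.log c := Real.log_nonneg hc
  have hden : -Real.log c + Real.log (1 - ε) < 0 := by linarith
  refine ⟨Real.log (1 - ε) / (-Real.log c + Real.log (1 - ε)), div_pos_of_neg_of_neg hL hden, ?_,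
    by rw [logRho, if_neg h, mul_div_assoc], fun _ => ?_⟩
  · rw [div_le_one_of_neg hden]; linarith
  · rw [Real.rpow_def_of_pos (by linarith), Real.rpow_def_of_pos (by linarith), ← Real.exp_add,
      Real.exp_eq_one_iff]
    field_simp [hden.ne]
    ring

theorem le_rpow_sub_rpow {x a b : ℝ} (hx : 0 < x) :
    x ^ b * ((b - a) * Real.log (1 / x)) ≤ x ^ a - x ^ b := by
  have h : x ^ a = x ^ b * Real.exp ((b - a) * Real.log (1 / x)) := by
    rw [Real.rpow_def_of_pos hx, Real.rpow_def_of_pos hx, ← Real.exp_add, one_div, Real.log_inv]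
    ring_nf
  have h2 := Real.add_one_le_exp ((b - a) * Real.log (1 / x))
  rw [h]
  nlinarith [Real.rpow_pos_of_pos hx b]

/-- In a recursion with factor `x ^ γ`, a forcing term of size `A γ` and of the slower geometric
ratio `x ^ (δ γ)` is absorbed by the multiple `m A log⁻¹ (1 / x) / x ^ γbar` of that geometric
sequence: the gap `x ^ (δ γ) - x ^ γ` is of order `γ log (1 / x)`, uniformly in `γ ≤ γbar`. -/
theorem mul_le_const_mul_rpow_sub {x A γ γbar δ m : ℝ} (hx : x ∈ Ioo (0 : ℝ) 1) (hA : 0 ≤ A)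
    (hγ : γ ∈ Ioc 0 γbar) (hm : 1 ≤ m * (1 - δ)) (hm0 : 0 ≤ m) :
    A * γ ≤ m * A * (Real.log (1 / x))⁻¹ / x ^ γbar * (x ^ (δ * γ) - x ^ γ) := by
  have hlog : 0 < Real.log (1 / x) := Real.log_pos (by rw [lt_div_iff₀ hx.1]; linarith [hx.2])
  have h := le_rpow_sub_rpow (a := δ * γ) (b := γ) hx.1
  have hpow : x ^ γbar ≤ x ^ γ := Real.rpow_le_rpow_of_exponent_ge hx.1 hx.2.le hγ.2
  have hp := Real.rpow_pos_of_pos hx.1 γbar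
  have hδ : 0 ≤ (1 - δ) := by
    by_contra hneg
    nlinarith
  calc A * γ ≤ A * γ * (m * (1 - δ)) := le_mul_of_one_le_right (mul_nonneg hA hγ.1.le) hm
    _ = m * A * (Real.log (1 / x))⁻¹ / x ^ γbar *
          (x ^ γbar * ((1 - δ) * γ * Real.log (1 / x))) := by field_simp
    _ ≤ m * A * (Real.log (1 / x))⁻¹ / x ^ γbar *
          (x ^ γ * ((1 - δ) * γ * Real.log (1 / x))) := by
        have := hγ.1
        gcongr
    _ ≤ _ := by
        gcongr
        refine le_trans (le_of_eq ?_) h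
        ring

/-- Trading the initial weight against time: with `s ≤ 1`, a survival probability controlled by
`(G ^ 2 lam ^ t) ^ s` is at most `G lam ^ (t / 4) + lam ^ (s t / 2)`, since only one of the two
regimes `G lam ^ (t / 4) ≥ 1` and `G lam ^ (t / 4) < 1` can occur. -/
theorem survival_le_add {lam s u v G t α : ℝ} (hlam : 0 < lam) (hs : 0 ≤ s)
    (hG : 0 < G) (hv0 : 0 ≤ v) (hv : v ≤ G) (hu : lam ^ (-u) ≤ G) (hα1 : α ≤ 1)
    (hα : α * lam ^ (s * u) ≤ lam ^ (s * t) * v ^ s) :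
    α ≤ G * lam ^ (t / 4) + (lam ^ s) ^ (t / 2) := by
  have hρ : 0 < (lam ^ s) ^ (t / 2) := by positivity
  have hl4 : 0 < lam ^ (t / 4) := by positivity
  rcases le_or_gt 1 (G * lam ^ (t / 4)) with h | h
  · linarith
  have h1 : α ≤ lam ^ (s * t) * v ^ s * lam ^ (-(s * u)) := by
    rwa [Real.rpow_neg hlam.le, ← div_eq_mul_inv, le_div_iff₀ (by positivity)]
  have h2 : lam ^ (s * t) * v ^ s * lam ^ (-(s * u)) = (lam ^ t * v * lam ^ (-u)) ^ s := by
    rw [Real.mul_rpow (by positivity) (by positivity), Real.mul_rpow (by positivity) hv0,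
      ← Real.rpow_mul hlam.le, ← Real.rpow_mul hlam.le]
    ring_nf
  have h3 : lam ^ t * v * lam ^ (-u) ≤ lam ^ (t / 2) := by
    have e : lam ^ t = lam ^ (t / 2) * lam ^ (t / 4) * lam ^ (t / 4) := by
      rw [← Real.rpow_add hlam, ← Real.rpow_add hlam]; ring_nf
    calc lam ^ t * v * lam ^ (-u) ≤ lam ^ t * G * G := by gcongr
      _ = lam ^ (t / 2) * ((G * lam ^ (t / 4)) * (G * lam ^ (t / 4))) := by rw [e]; ring
      _ ≤ lam ^ (t / 2) * 1 := by
          gcongr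
          exact mul_le_one₀ h.le (by positivity) h.le
      _ = _ := mul_one _
  have h4 : (lam ^ t * v * lam ^ (-u)) ^ s ≤ (lam ^ (t / 2)) ^ s :=
    Real.rpow_le_rpow (by positivity) h3 hs
  have h5 : (lam ^ (t / 2)) ^ s = (lam ^ s) ^ (t / 2) := by
    rw [← Real.rpow_mul hlam.le, ← Real.rpow_mul hlam.le, mul_comm]
  have : 0 ≤ G * lam ^ (t / 4) := by positivity
  linarith [h1.trans (h2.le.trans h4), h5.le]

/-- Solution of the recursion `u (k + 1) ≤ a u k + b α k` when the forcing term `α` is the sum of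
two geometric sequences of ratios `x, y > a`. -/
theorem recursion_le {u α : ℕ → ℝ≥0∞} {a b x y G P Q v : ℝ} (ha : 0 ≤ a) (hb : 0 ≤ b)
    (hx : 0 ≤ x) (hy : 0 ≤ y) (hG : 0 ≤ G) (hP : 0 ≤ P) (hQ : 0 ≤ Q) (hv : 0 ≤ v)
    (hbP : b ≤ P * (x - a)) (hbQ : b ≤ Q * (y - a)) (h0 : u 0 ≤ ENNReal.ofReal v)
    (hu : ∀ k, u (k + 1) ≤ ENNReal.ofReal a * u k + ENNReal.ofReal b * α k)
    (hα : ∀ k, α k ≤ ENNReal.ofReal (G * x ^ k + y ^ k)) (k : ℕ) :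
    u k ≤ ENNReal.ofReal (a ^ k * v + P * G * x ^ k + Q * y ^ k) := by
  induction k with
  | zero =>
    refine h0.trans (ENNReal.ofReal_le_ofReal ?_)
    simp only [pow_zero, one_mul, mul_one]
    nlinarith [mul_nonneg hP hG]
  | succ k ih =>
    have hxk := pow_nonneg hx k
    have hyk := pow_nonneg hy k
    refine (hu k).trans ?_
    calc _ ≤ ENNReal.ofReal a * ENNReal.ofReal (a ^ k * v + P * G * x ^ k + Q * y ^ k)
          + ENNReal.ofReal b * ENNReal.ofReal (G * x ^ k + y ^ k) := by gcongr; exact hα k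
      _ = ENNReal.ofReal (a * (a ^ k * v + P * G * x ^ k + Q * y ^ k)
          + b * (G * x ^ k + y ^ k)) := by
        rw [← ENNReal.ofReal_mul ha, ← ENNReal.ofReal_mul hb,
          ← ENNReal.ofReal_add (by positivity) (by positivity)]
      _ ≤ _ := by
        apply ENNReal.ofReal_le_ofReal
        have h1 := mul_le_mul_of_nonneg_right hbP (mul_nonneg hG hxk)
        have h2 := mul_le_mul_of_nonneg_right hbQ hyk
        simp only [pow_succ]
        linarith

/-- The number of steps `l ⌈1 / γ⌉` of size `γ` covers at most the time `(1 + γbar) l`. -/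
theorem mul_ceil_mul_le {γ γbar : ℝ} (hγ : γ ∈ Ioc 0 γbar) (l : ℕ) :
    ((l * ⌈1 / γ⌉₊ : ℕ) : ℝ) * γ ≤ (1 + γbar) * l := by
  have h1 := (Nat.ceil_lt_add_one (one_div_pos.2 hγ.1).le).le
  have h2 : (⌈1 / γ⌉₊ : ℝ) * γ ≤ 1 + γ := by
    calc (⌈1 / γ⌉₊ : ℝ) * γ ≤ (1 / γ + 1) * γ := by have := hγ.1; gcongr
      _ = 1 + γ := by field_simp [hγ.1.ne']
  push_cast
  calc (l : ℝ) * ⌈1 / γ⌉₊ * γ = l * (⌈1 / γ⌉₊ * γ) := by ring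
    _ ≤ l * (1 + γbar) := by gcongr; linarith [hγ.2]
    _ = _ := mul_comm _ _

/-- The additive constant accumulated by the drift inequality over a time `u ≤ (1 + γbar) l`. -/
theorem mul_rpow_neg_le_growth {lam A γbar u : ℝ} {l : ℕ} (hlam : lam ∈ Ioo (0 : ℝ) 1)
    (hA : 0 ≤ A) (hu0 : 0 ≤ u) (hu : u ≤ (1 + γbar) * l) :
    A * u * lam ^ (-u) ≤ growth lam A γbar l := by
  have h : lam ^ (-u) ≤ lam ^ (-((1 + γbar) * l)) :=
    Real.rpow_le_rpow_of_exponent_ge hlam.1 hlam.2.le (by linarith)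
  have := Real.rpow_pos_of_pos hlam.1 (-u)
  calc A * u * lam ^ (-u) ≤ A * ((1 + γbar) * l) * lam ^ (-((1 + γbar) * l)) := by
        gcongr
        exact mul_nonneg hA (hu0.trans hu)
    _ = _ := by rw [growth]; ring

theorem growth_nonneg {lam A γbar : ℝ} (hlam : 0 < lam) (hA : 0 ≤ A) (hγbar : 0 < γbar) (l : ℕ) :
    0 ≤ growth lam A γbar l := by
  unfold growth; positivity

/-- An explicit bound for `1 / log (1 / ρ)`, which is
`(1 + log c / (-log (1 - ε))) / log (1 / lam)`; the estimate rests on `ε ≤ -log (1 - ε)` and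
`c ≤ B (1 + 2 A l) lam ^ (-2 l)`. -/
theorem inv_log_inv_rho_le {lam A γbar B ε : ℝ} {l : ℕ} (hlam : lam ∈ Ioo (0 : ℝ) 1)
    (hA : 0 ≤ A) (hγbar : 0 < γbar) (hγbar1 : γbar ≤ 1) (hB : 1 ≤ B) (hε0 : 0 < ε) (hε1 : ε < 1) :
    (Real.log (Real.exp (logRho lam ε (constc B lam A γbar l)))⁻¹)⁻¹
      ≤ (1 + Real.log B + Real.log (1 + 2 * A * l) + 2 * l * Real.log lam⁻¹)
          / (Real.log lam⁻¹ * ε) := by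
  set c := constc B lam A γbar l with hc
  have hlam0 := hlam.1
  have hg : growth lam A γbar l ≤ 2 * A * l * lam ^ (-(2 * l : ℝ)) := by
    have h : lam ^ (-((1 + γbar) * l)) ≤ lam ^ (-(2 * l : ℝ)) :=
      Real.rpow_le_rpow_of_exponent_ge hlam.1 hlam.2.le (by
        have : (0 : ℝ) ≤ l := l.cast_nonneg
        nlinarith)
    have := Real.rpow_pos_of_pos hlam0 (-((1 + γbar) * l))
    calc growth lam A γbar l ≤ A * lam ^ (-(2 * l : ℝ)) * 2 * l := by
          unfold growth; gcongr; linarith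
      _ = _ := by ring
  have hc1 : 1 ≤ c := by
    have := growth_nonneg hlam0 hA hγbar l
    rw [hc, constc]; linarith
  have hll : 0 < Real.log lam⁻¹ := Real.log_pos ((one_lt_inv₀ hlam0).2 hlam.2)
  have hp : 1 ≤ lam ^ (-(2 * l : ℝ)) :=
    Real.one_le_rpow_of_pos_of_le_one_of_nonpos hlam0 hlam.2.le (by simp)
  have hAl : 0 ≤ 2 * A * l := by positivity
  have hcle : c ≤ B * (1 + 2 * A * l) * lam ^ (-(2 * l : ℝ)) := by
    calc c ≤ B * 1 + 1 * (2 * A * l * lam ^ (-(2 * l : ℝ))) := by rw [hc, constc]; linarith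
      _ ≤ B * lam ^ (-(2 * l : ℝ)) + B * (2 * A * l * lam ^ (-(2 * l : ℝ))) := by gcongr
      _ = _ := by ring
  have hlogc : Real.log c ≤ Real.log B + Real.log (1 + 2 * A * l) + 2 * l * Real.log lam⁻¹ := by
    refine (Real.log_le_log (by linarith) hcle).trans (le_of_eq ?_)
    rw [Real.log_mul (by positivity) (by positivity), Real.log_mul (by positivity) (by positivity),
      Real.log_rpow hlam0, Real.log_inv]
    ring
  have hL : ε ≤ -Real.log (1 - ε) := by
    have := Real.log_le_sub_one_of_pos (show 0 < 1 - ε by linarith)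
    linarith
  have hc0 := Real.log_nonneg hc1
  have hL0 : 0 < -Real.log (1 - ε) := by linarith
  have key : (Real.log (Real.exp (logRho lam ε c))⁻¹)⁻¹
      = (1 + Real.log c / (-Real.log (1 - ε))) / Real.log lam⁻¹ := by
    rw [Real.log_inv, Real.log_exp, logRho, if_neg hε1.ne, Real.log_inv]
    have h1 : Real.log lam ≠ 0 := (Real.log_neg hlam0 hlam.2).ne
    have h2 : Real.log (1 - ε) ≠ 0 := by linarith
    have h3 : -Real.log c + Real.log (1 - ε) ≠ 0 := by linarith
    field_simp
    ring
  rw [key]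
  calc (1 + Real.log c / (-Real.log (1 - ε))) / Real.log lam⁻¹
      ≤ (1 / ε + Real.log c / ε) / Real.log lam⁻¹ := by
        gcongr
        rw [le_div_iff₀ hε0]; linarith
    _ = (1 + Real.log c) / (Real.log lam⁻¹ * ε) := by field_simp
    _ ≤ _ := by gcongr ?_ / _; linarith

end Constants

/-! ### Decay under a drift condition -/

section Decay

variable {Y : Type*} [MeasurableSpace Y] {κ : Kernel Y Y}

theorem DriftCondition.lintegral_le {V : Y → ℝ} {a b : ℝ} {C : Set Y}
    (h : DriftCondition κ V a b C) (ha : 0 ≤ a) (hb : 0 ≤ b) (hV1 : ∀ y, 1 ≤ V y) (y : Y) :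
    ∫⁻ z, ENNReal.ofReal (V z) ∂κ y
      ≤ ENNReal.ofReal a * ENNReal.ofReal (V y) + ENNReal.ofReal b := by
  have hVy := hV1 y
  rw [← ENNReal.ofReal_mul ha, ← ENNReal.ofReal_add (by positivity) hb]
  refine (h y).trans (ENNReal.ofReal_le_ofReal ?_)
  gcongr
  refine mul_le_of_le_one_right hb (indicator_apply_le' (fun _ => le_rfl) fun _ => zero_le_one)

theorem DriftCondition.lintegral_le_of_notMem {V : Y → ℝ} {a b : ℝ} {C : Set Y}
    (h : DriftCondition κ V a b C) (ha : 0 ≤ a) {y : Y} (hy : y ∉ C) :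
    ∫⁻ z, ENNReal.ofReal (V z) ∂κ y ≤ ENNReal.ofReal a * ENNReal.ofReal (V y) := by
  simpa [← ENNReal.ofReal_mul ha, hy] using h y

theorem DriftCondition.lintegral_pow_le {V : Y → ℝ} {a b : ℝ} {C : Set Y} [IsMarkovKernel κ]
    (h : DriftCondition κ V a b C) (ha : 0 ≤ a) (ha1 : a ≤ 1) (hb : 0 ≤ b) (hV : Measurable V)
    (hV1 : ∀ y, 1 ≤ V y) (n : ℕ) (y : Y) :
    ∫⁻ z, ENNReal.ofReal (V z) ∂(κ ^ n) y ≤ ENNReal.ofReal (a ^ n * V y + n * b) := by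
  have hVy := hV1 y
  refine (lintegral_pow_le_of_drift hV.ennreal_ofReal (ENNReal.ofReal_le_one.2 ha1)
    (h.lintegral_le ha hb hV1) n y).trans (le_of_eq ?_)
  rw [ENNReal.ofReal_add (by positivity) (by positivity), ENNReal.ofReal_mul (by positivity),
    ENNReal.ofReal_mul (by positivity), ENNReal.ofReal_pow ha, ENNReal.ofReal_natCast]

theorem one_le_lintegral_of_one_le {V : Y → ℝ} [IsMarkovKernel κ] (hV1 : ∀ y, 1 ≤ V y) (n : ℕ)
    (y : Y) : 1 ≤ ∫⁻ z, ENNReal.ofReal (V z) ∂(κ ^ n) y := by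
  have := isMarkovKernel_pow κ n
  calc (1 : ℝ≥0∞) = ∫⁻ _, 1 ∂(κ ^ n) y := by simp
    _ ≤ _ := lintegral_mono fun z => by simpa using hV1 z

/-- A function `V ≥ 1` cannot contract everywhere, so the exceptional set of a drift condition is
nonempty. -/
theorem DriftCondition.nonempty {V : Y → ℝ} {a b : ℝ} {C : Set Y} [IsMarkovKernel κ] [Nonempty Y]
    (h : DriftCondition κ V a b C) (ha : 0 ≤ a) (ha1 : a < 1) (hV : Measurable V)
    (hV1 : ∀ y, 1 ≤ V y) : C.Nonempty := by
  by_contra hC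
  rw [not_nonempty_iff_eq_empty] at hC
  subst hC
  obtain ⟨y⟩ := ‹Nonempty Y›
  have h0 : DriftCondition κ V a 0 ∅ := fun z => by simpa using h z
  have hVy : 0 < V y := one_pos.trans_le (hV1 y)
  obtain ⟨n, hn⟩ := exists_pow_lt_of_lt_one (inv_pos.2 hVy) ha1
  have h1 := (one_le_lintegral_of_one_le hV1 n y).trans
    (h0.lintegral_pow_le ha ha1.le le_rfl hV hV1 n y)
  rw [ENNReal.one_le_ofReal] at h1
  have h2 : a ^ n * V y < 1 := by
    calc a ^ n * V y < (V y)⁻¹ * V y := by gcongr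
      _ = 1 := inv_mul_cancel₀ hVy.ne'
  simp only [mul_zero, add_zero] at h1
  linarith

/-- From `C`, over `n` steps, the part of `V ^ s` that is not absorbed contracts by
`(lam ^ γ) ^ (s n)`: this is where the exponent `s` is chosen so that the Hölder interpolation
between the growth `c` and the failure probability `1 - ε` is at most `1`. -/
theorem DriftCondition.setLIntegral_rpow_pow_le {V : Y → ℝ} {lam A γ γbar B ε s : ℝ} {l n : ℕ}
    {C N : Set Y} [IsMarkovKernel κ] (h : DriftCondition κ V (lam ^ γ) (A * γ) C)
    (hlam : lam ∈ Ioo (0 : ℝ) 1) (hA : 0 ≤ A) (hγ : 0 < γ) (hV : Measurable V)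
    (hV1 : ∀ y, 1 ≤ V y) (hn : n * γ ≤ (1 + γbar) * l) {y : Y} (hy : V y ≤ B)
    (hs0 : 0 < s) (hs1 : s ≤ 1) (hε1 : ε ≤ 1)
    (hs : ε ≠ 1 → (1 - ε) ^ (1 - s) * constc B lam A γbar l ^ s = 1)
    (hN : (κ ^ n) y N ≤ ENNReal.ofReal (1 - ε)) :
    ∫⁻ z in N, ENNReal.ofReal (V z) ^ s ∂(κ ^ n) y ≤ (ENNReal.ofReal (lam ^ γ) ^ s) ^ n := by
  rcases eq_or_ne ε 1 with hε | hε
  · rw [hε, sub_self, ENNReal.ofReal_zero, nonpos_iff_eq_zero] at hN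
    rw [setLIntegral_measure_zero _ _ hN]
    exact zero_le
  have hlam0 := hlam.1
  have ha : 0 < lam ^ γ := Real.rpow_pos_of_pos hlam0 γ
  have ha1 : lam ^ γ ≤ 1 := Real.rpow_le_one hlam0.le hlam.2.le hγ.le
  have hpow : (lam ^ γ) ^ n = lam ^ (n * γ) := by
    rw [← Real.rpow_natCast, ← Real.rpow_mul hlam0.le, mul_comm]
  set c := constc B lam A γbar l with hc
  have hg := mul_rpow_neg_le_growth hlam hA (by positivity) hn
  have hc0 : 0 ≤ c := by
    have : 0 ≤ A * (n * γ) * lam ^ (-(n * γ)) := by positivity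
    rw [hc, constc]
    linarith [hV1 y]
  have hint : ∫⁻ z, ENNReal.ofReal (V z) ∂(κ ^ n) y ≤ ENNReal.ofReal (lam ^ γ) ^ n *
      ENNReal.ofReal c := by
    refine (h.lintegral_pow_le ha.le ha1 (by positivity) hV hV1 n y).trans ?_
    rw [← ENNReal.ofReal_pow ha.le, ← ENNReal.ofReal_mul (by positivity)]
    refine ENNReal.ofReal_le_ofReal ?_
    have e : n * (A * γ) = (lam ^ γ) ^ n * (A * (n * γ) * lam ^ (-(n * γ))) := by
      rw [hpow, Real.rpow_neg hlam0.le]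
      field_simp
    rw [e, ← mul_add, hc, constc]
    gcongr
  calc ∫⁻ z in N, ENNReal.ofReal (V z) ^ s ∂(κ ^ n) y
      ≤ (κ ^ n) y N ^ (1 - s) * (∫⁻ z, ENNReal.ofReal (V z) ∂(κ ^ n) y) ^ s :=
        setLIntegral_rpow_le N hV.ennreal_ofReal hs0.le hs1
    _ ≤ ENNReal.ofReal (1 - ε) ^ (1 - s) * (ENNReal.ofReal (lam ^ γ) ^ n * ENNReal.ofReal c) ^ s := by
        gcongr
    _ = (ENNReal.ofReal (1 - ε) ^ (1 - s) * ENNReal.ofReal c ^ s) *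
          (ENNReal.ofReal (lam ^ γ) ^ s) ^ n := by
        rw [ENNReal.mul_rpow_of_nonneg _ _ hs0.le, ← ENNReal.rpow_natCast, ← ENNReal.rpow_natCast,
          ← ENNReal.rpow_mul, ← ENNReal.rpow_mul, mul_comm s]
        ring
    _ = _ := by
        rw [ENNReal.ofReal_rpow_of_nonneg (by linarith) (sub_nonneg.2 hs1),
          ENNReal.ofReal_rpow_of_nonneg hc0 hs0.le, ← ENNReal.ofReal_mul
            (Real.rpow_nonneg (by linarith) _), hs hε, ENNReal.ofReal_one, one_mul]

/-- Over the time `n γ` needed for one coupling attempt, `lam ^ (-n γ)` is dominated by the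
weight `V + growth` of any starting point: apply `n` drift steps to `V ≥ 1`. -/
theorem DriftCondition.rpow_neg_le {V : Y → ℝ} {lam A γ γbar : ℝ} {l n : ℕ} {C : Set Y}
    [IsMarkovKernel κ] (h : DriftCondition κ V (lam ^ γ) (A * γ) C) (hlam : lam ∈ Ioo (0 : ℝ) 1)
    (hA : 0 ≤ A) (hγ : 0 < γ) (hV : Measurable V) (hV1 : ∀ y, 1 ≤ V y)
    (hn : n * γ ≤ (1 + γbar) * l) (y : Y) :
    lam ^ (-(n * γ)) ≤ V y + growth lam A γbar l := by
  have hlam0 := hlam.1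
  have ha : 0 < lam ^ γ := Real.rpow_pos_of_pos hlam0 γ
  have h1 := (one_le_lintegral_of_one_le hV1 n y).trans (h.lintegral_pow_le ha.le
    (Real.rpow_le_one hlam0.le hlam.2.le hγ.le) (by positivity) hV hV1 n y)
  rw [ENNReal.one_le_ofReal, ← Real.rpow_natCast, ← Real.rpow_mul hlam0.le, mul_comm γ] at h1
  have hg := mul_rpow_neg_le_growth hlam hA (by positivity) hn
  have hp : 0 < lam ^ (n * γ) := Real.rpow_pos_of_pos hlam0 _
  have hq : 0 < lam ^ (-(n * γ)) := Real.rpow_pos_of_pos hlam0 _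
  have hpq : lam ^ (-(n * γ)) * lam ^ (n * γ) = 1 := by
    rw [← Real.rpow_add hlam0]; simp
  calc lam ^ (-(n * γ)) ≤ lam ^ (-(n * γ)) * (lam ^ (n * γ) * V y + n * (A * γ)) :=
        le_mul_of_one_le_right hq.le h1
    _ = lam ^ (-(n * γ)) * lam ^ (n * γ) * V y + A * (n * γ) * lam ^ (-(n * γ)) := by ring
    _ ≤ _ := by rw [hpq]; linarith

/-- Quantitative decay of `∫ 1_N V dκ^k` for a chain absorbed outside `N`, from a drift condition
towards `C` and a lower bound `ε` on the probability of absorption within `n` steps from `C`. -/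
theorem DriftCondition.lintegral_indicator_pow_le {V : Y → ℝ} {lam A γ γbar B ε : ℝ} {l n : ℕ}
    {C N : Set Y} [IsMarkovKernel κ] (h : DriftCondition κ V (lam ^ γ) (A * γ) C)
    (hlam : lam ∈ Ioo (0 : ℝ) 1) (hA : 0 ≤ A) (hγ : γ ∈ Ioc 0 γbar) (hV : Measurable V)
    (hV1 : ∀ y, 1 ≤ V y) (hN : MeasurableSet N) (habs : ∀ y ∉ N, κ y N = 0)
    (hn1 : 1 ≤ n) (hn : n * γ ≤ (1 + γbar) * l) (hB1 : 1 ≤ B) (hB : ∀ y ∈ C, V y ≤ B)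
    (hε0 : 0 < ε) (hε1 : ε ≤ 1) (hmin : ∀ y ∈ C, (κ ^ n) y N ≤ ENNReal.ofReal (1 - ε))
    (k : ℕ) (y : Y) :
    ∫⁻ z, N.indicator (fun z => ENNReal.ofReal (V z)) z ∂(κ ^ k) y
      ≤ ENNReal.ofReal (lam ^ (k * γ / 4) *
            (constD₁ lam A γbar * V y + constD₂ lam A γbar l)
          + constC₁ (Real.exp (logRho lam ε (constc B lam A γbar l))) A γbar *
            Real.exp (logRho lam ε (constc B lam A γbar l)) ^ (k * γ / 4)) := by
  have hlam0 := hlam.1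
  have hγ0 := hγ.1
  have hg0 := growth_nonneg hlam0 hA (hγ0.trans_le hγ.2) l
  obtain ⟨s, hs0, hs1, hs, hs2⟩ := exists_logRho_eq (lam := lam)
    (c := constc B lam A γbar l) hε0 hε1 (by rw [constc]; linarith)
  have hρ : Real.exp (logRho lam ε (constc B lam A γbar l)) = lam ^ s := by
    rw [hs, Real.rpow_def_of_pos hlam0]
  rw [hρ]
  set ρ := lam ^ s with hρdef
  have hρ0 : 0 < ρ := Real.rpow_pos_of_pos hlam0 s
  have hρ1 : ρ < 1 := Real.rpow_lt_one hlam0.le hlam.2 hs0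
  have hlamρ : lam ≤ ρ := by
    simpa using Real.rpow_le_rpow_of_exponent_ge hlam0 hlam.2.le hs1
  set G := V y + growth lam A γbar l with hG
  have hVy := hV1 y
  have ha : 0 < lam ^ γ := Real.rpow_pos_of_pos hlam0 γ
  have ha1 : lam ^ γ ≤ 1 := Real.rpow_le_one hlam0.le hlam.2.le hγ0.le
  have hx : ∀ (x δ : ℝ) (j : ℕ), 0 < x → (x ^ (δ * γ)) ^ j = x ^ (δ * (j * γ)) := by
    intro x δ j hx
    rw [← Real.rpow_natCast, ← Real.rpow_mul hx.le]
    ring_nf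
  -- the survival probability is dominated by two geometric sequences, of rates `lam` and `ρ`
  have hsurv : ∀ j : ℕ, (κ ^ j) y N
      ≤ ENNReal.ofReal (G * (lam ^ (1 / 4 * γ)) ^ j + (ρ ^ (1 / 2 * γ)) ^ j) := by
    intro j
    have := isMarkovKernel_pow κ j
    have hr : ENNReal.ofReal (lam ^ γ) ^ s = ENNReal.ofReal (lam ^ (s * γ)) := by
      rw [ENNReal.ofReal_rpow_of_pos ha, ← Real.rpow_mul hlam0.le, mul_comm]
    have h1 := pow_apply_mul_le_of_contraction hN habs hV.ennreal_ofReal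
      (fun z => by simpa using hV1 z) (ENNReal.ofReal_le_one.2 ha1) hs0 hs1 hn1
      (fun z hz => h.lintegral_le_of_notMem ha.le hz)
      (fun z hz => h.setLIntegral_rpow_pow_le hlam hA hγ0 hV hV1 hn (hB z hz) hs0 hs1 hε1 hs2
        (hmin z hz)) j y
    rw [hr, ENNReal.ofReal_rpow_of_nonneg (by linarith) hs0.le, ← ENNReal.ofReal_pow (by positivity),
      ← ENNReal.ofReal_pow (by positivity), ← ENNReal.ofReal_mul (by positivity),
      hx _ _ _ hlam0, hx _ _ _ hlam0, ← ENNReal.ofReal_toReal (measure_ne_top ((κ ^ j) y) N),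
      ← ENNReal.ofReal_mul ENNReal.toReal_nonneg, ENNReal.ofReal_le_ofReal_iff (by positivity)] at h1
    rw [← ENNReal.ofReal_toReal (measure_ne_top ((κ ^ j) y) N), hx _ _ _ hlam0, hx _ _ _ hρ0]
    refine ENNReal.ofReal_le_ofReal ?_
    have h2 := survival_le_add (G := G) hlam0 hs0.le (by positivity) (by linarith) (by linarith)
      (h.rpow_neg_le hlam hA hγ0 hV hV1 hn y)
      (ENNReal.toReal_le_of_le_ofReal zero_le_one (by simpa using prob_le_one)) h1
    refine h2.trans (le_of_eq ?_)
    rw [hρdef]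
    ring_nf
  have hlogl : 0 ≤ Real.log (1 / lam) := Real.log_nonneg (by rw [le_div_iff₀ hlam0]; linarith [hlam.2])
  have hlogρ : 0 ≤ Real.log (1 / ρ) := Real.log_nonneg (by rw [le_div_iff₀ hρ0]; linarith)
  have hP0 : 0 ≤ 4 * A * (Real.log (1 / lam))⁻¹ / lam ^ γbar := by positivity
  have hQ0 : 0 ≤ 8 * A * (Real.log (1 / ρ))⁻¹ / ρ ^ γbar := by positivity
  have hbP := mul_le_const_mul_rpow_sub (δ := 1 / 4) (m := 4) hlam hA hγ (by norm_num) (by norm_num)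
  have hbQ : A * γ ≤ 8 * A * (Real.log (1 / ρ))⁻¹ / ρ ^ γbar * (ρ ^ (1 / 2 * γ) - lam ^ γ) := by
    refine (mul_le_const_mul_rpow_sub (δ := 1 / 2) (m := 8) ⟨hρ0, hρ1⟩ hA hγ (by norm_num)
      (by norm_num)).trans ?_
    gcongr
  have hrec := recursion_le (u := fun j => ∫⁻ z, N.indicator (fun z => ENNReal.ofReal (V z)) z
      ∂(κ ^ j) y) (v := V y) ha.le (by positivity) (by positivity) (by positivity) (by positivity)
    hP0 hQ0 (by linarith) hbP hbQ ?_ (fun j => lintegral_indicator_pow_succ_le hN habs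
      hV.ennreal_ofReal (h.lintegral_le ha.le (by positivity) hV1) j y) hsurv k
  · refine hrec.trans (ENNReal.ofReal_le_ofReal ?_)
    rw [hx _ _ _ hlam0, hx _ _ _ hρ0]
    have e1 : (lam ^ γ) ^ k ≤ lam ^ (k * γ / 4) := by
      rw [← Real.rpow_natCast, ← Real.rpow_mul hlam0.le]
      refine Real.rpow_le_rpow_of_exponent_ge hlam0 hlam.2.le ?_
      have : 0 ≤ γ * k := by positivity
      linarith
    have e2 : ρ ^ (1 / 2 * (k * γ)) ≤ ρ ^ (k * γ / 4) := by
      refine Real.rpow_le_rpow_of_exponent_ge hρ0 hρ1.le ?_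
      have : 0 ≤ k * γ := by positivity
      linarith
    have e3 : lam ^ (1 / 4 * (k * γ)) = lam ^ (k * γ / 4) := by ring_nf
    rw [e3, constC₁]
    have e4 : lam ^ (k * γ / 4) * (constD₁ lam A γbar * V y + constD₂ lam A γbar l)
        = lam ^ (k * γ / 4) * (V y + growth lam A γbar l)
          + 4 * A * (Real.log (1 / lam))⁻¹ / lam ^ γbar * G * lam ^ (k * γ / 4) := by
      rw [constD₂, constD₁, hG]; ring
    rw [e4]
    have e5 : (lam ^ γ) ^ k * V y ≤ lam ^ (k * γ / 4) * (V y + growth lam A γbar l) := by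
      gcongr
      linarith
    have e6 := mul_le_mul_of_nonneg_left e2 hQ0
    linarith
  · change ∫⁻ z, N.indicator _ z ∂Kernel.id y ≤ _
    rw [Kernel.id_apply, lintegral_dirac' _ (hV.ennreal_ofReal.indicator hN)]
    exact indicator_le_self N _ y

end Decay

/-! ### The cost on the product space -/

section Cost

variable {Y : Type*}

theorem ofReal_cost (V : Y × Y → ℝ) :
    (fun p => ENNReal.ofReal (cost V p)) =
      (diagonal Y)ᶜ.indicator (fun p => ENNReal.ofReal (V p)) := by
  funext p
  by_cases hp : p ∈ (diagonal Y)ᶜ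
  · simp [cost, offDiag, indicator_of_mem hp]
  · simp [cost, offDiag, indicator_of_notMem hp]

theorem offDiag_of_ne {p : Y × Y} (hp : p ∈ (diagonal Y)ᶜ) : offDiag p = 1 :=
  indicator_of_mem hp _

end Cost

section EpsBar

variable {d : ℕ} {X : Set (EuclideanSpace ℝ (Fin d))} {Ψ : ℝ → ℕ → ℝ → ℝ} {γbar M : ℝ} {l : ℕ}

theorem epsBar_le (hΨ : ∀ γ ∈ Ioc 0 γbar, ∀ t : ℝ, 0 ≤ t → Ψ γ l t ∈ Icc (0 : ℝ) 1)
    {γ : ℝ} (hγ : γ ∈ Ioc 0 γbar) {p : X × X} (hp : p ∈ closePairs X M) :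
    epsBar X Ψ γbar M l ≤ Ψ γ l ‖(p.1 : EuclideanSpace ℝ (Fin d)) - p.2‖ := by
  refine csInf_le ⟨0, ?_⟩ ⟨γ, hγ, p, hp, rfl⟩
  rintro _ ⟨γ', hγ', q, -, rfl⟩
  exact (hΨ γ' hγ' _ (norm_nonneg _)).1

end EpsBar

end FunctionalAR

theorem theorem8 {d : ℕ} (X : Set (EuclideanSpace ℝ (Fin d))) (hX : MeasurableSet X)
    -- the autoregressive model: `S` is the map `Π`, and `T γ` is `T_γ` for `γ ∈ (0, γbar]`
    (γbar : ℝ) (hγbar : 0 < γbar)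
    (S : EuclideanSpace ℝ (Fin d) → X) (hS : Measurable S)
    (T : ℝ → X → EuclideanSpace ℝ (Fin d)) (hT : ∀ γ ∈ Ioc 0 γbar, Measurable (T γ))
    -- the drift condition for the coupling kernels `K γ`
    (lam A M : ℝ) (hlam : lam ∈ Ioo (0 : ℝ) 1) (hA : 0 ≤ A) (hM : 0 < M)
    (V : X × X → ℝ) (hV : Measurable V) (hV1 : ∀ p, 1 ≤ V p)
    (C : Set (X × X)) (hC : MeasurableSet C) (hCM : C ⊆ FunctionalAR.closePairs X M)
    (K : ℝ → Kernel (X × X) (X × X))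
    (hK : ∀ γ ∈ Ioc 0 γbar,
      FunctionalAR.IsMarkovCoupling (K γ) (FunctionalAR.arKernel S (T γ) γ))
    (hdrift : ∀ γ ∈ Ioc 0 γbar, FunctionalAR.DriftCondition (K γ) V (lam ^ γ) (A * γ) C)
    -- the diagonal is absorbing
    (habs : ∀ γ ∈ Ioc 0 γbar, ∀ x : X, K γ (x, x) (diagonal X) = 1)
    -- the minorization condition for the iterated kernels
    (Ψ : ℝ → ℕ → ℝ → ℝ)
    (hΨ : ∀ γ ∈ Ioc 0 γbar, ∀ l : ℕ, 1 ≤ l → ∀ t : ℝ, 0 ≤ t → Ψ γ l t ∈ Icc (0 : ℝ) 1)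
    (hminor : ∀ γ ∈ Ioc 0 γbar, ∀ l : ℕ, 1 ≤ l → ∀ x y : X,
      (K γ ^ (l * ⌈1 / γ⌉₊)) (x, y) (diagonal X)ᶜ
        ≤ ENNReal.ofReal (1 - Ψ γ l ‖(x : EuclideanSpace ℝ (Fin d)) - y‖))
    (hΨpos : ∀ γ ∈ Ioc 0 γbar, ∀ l : ℕ, 1 ≤ l → ∀ N : ℝ, 0 ≤ N →
      0 < ⨅ p : FunctionalAR.closePairs X N,
        Ψ γ l ‖(p.1.1 : EuclideanSpace ℝ (Fin d)) - p.1.2‖) :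
    (∀ γ ∈ Ioc 0 γbar, ∀ (k : ℕ) (x y : X),
      FunctionalAR.wassersteinCost (FunctionalAR.cost V)
          ((FunctionalAR.arKernel S (T γ) γ ^ k) x) ((FunctionalAR.arKernel S (T γ) γ ^ k) y)
        ≤ ∫⁻ p, ENNReal.ofReal (FunctionalAR.cost V p) ∂((K γ ^ k) (x, y))) ∧
    (∀ l : ℕ, 1 ≤ l →
      ∀ B ε c ρ D₁ D₂ C₁ : ℝ,
      B = FunctionalAR.supB V C →
      ε = FunctionalAR.epsBar X Ψ γbar M l →
      c = FunctionalAR.constc B lam A γbar l →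
      ρ = Real.exp (FunctionalAR.logRho lam ε c) →
      D₁ = FunctionalAR.constD₁ lam A γbar →
      D₂ = FunctionalAR.constD₂ lam A γbar l →
      C₁ = FunctionalAR.constC₁ ρ A γbar →
      -- if one of these two fails, then `ρ = 1` and `C₁ = ∞` and the bounds say nothing
      BddAbove (V '' C) → 0 < ε →
        (∀ γ ∈ Ioc 0 γbar, ∀ (k : ℕ) (x y : X),
          ∫⁻ p, ENNReal.ofReal (FunctionalAR.cost V p) ∂((K γ ^ k) (x, y))
            ≤ ENNReal.ofReal
                (lam ^ (k * γ / 4) *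
                    (D₁ * FunctionalAR.cost V (x, y) + D₂ * FunctionalAR.offDiag (x, y))
                  + C₁ * ρ ^ (k * γ / 4) * FunctionalAR.offDiag (x, y))) ∧
        (γbar ≤ 1 → ε ≤ 1 - Real.exp (-1) →
          (Real.log ρ⁻¹)⁻¹
            ≤ (1 + Real.log B + Real.log (1 + 2 * A * l) + 2 * l * Real.log lam⁻¹)
                / (Real.log lam⁻¹ * ε))) := by
  have hNm : MeasurableSet (diagonal X)ᶜ := measurableSet_diagonal.compl
  have hne : Nonempty X := ⟨S 0⟩
  refine ⟨fun γ hγ k x y =>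
    iInf₂_le_of_le _ ((hK γ hγ).isTransferencePlan_pow k (x, y)) le_rfl, ?_⟩
  rintro l hl B ε c ρ D₁ D₂ C₁ hB hε rfl rfl rfl rfl rfl hbdd hε0
  have hγm : γbar ∈ Ioc 0 γbar := ⟨hγbar, le_rfl⟩
  -- the supremum `B` is over a nonempty set, so that it is at least `1`
  have hCne : C.Nonempty := by
    have := (hK γbar hγm).isMarkovKernel
    exact (hdrift γbar hγm).nonempty (Real.rpow_nonneg hlam.1.le _)
      (Real.rpow_lt_one hlam.1.le hlam.2 hγbar) hV hV1
  have hVB : ∀ p ∈ C, V p ≤ B := fun p hp => hB ▸ le_csSup hbdd (mem_image_of_mem V hp)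
  have hεΨ : ∀ γ ∈ Ioc 0 γbar, ∀ p ∈ C,
      ε ≤ Ψ γ l ‖(p.1 : EuclideanSpace ℝ (Fin d)) - p.2‖ := fun γ hγ p hp =>
    hε ▸ FunctionalAR.epsBar_le (fun γ hγ t ht => hΨ γ hγ l hl t ht) hγ (hCM hp)
  obtain ⟨p₀, hp₀⟩ := hCne
  have hB1 : 1 ≤ B := (hV1 p₀).trans (hVB p₀ hp₀)
  have hε1 : ε ≤ 1 :=
    (hεΨ γbar hγm p₀ hp₀).trans (hΨ γbar hγm l hl _ (norm_nonneg _)).2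
  refine ⟨fun γ hγ k x y => ?_, fun hγ1 hεe => FunctionalAR.inv_log_inv_rho_le hlam hA hγbar hγ1 hB1
    hε0 (hεe.trans_lt (sub_lt_self 1 (Real.exp_pos _)))⟩
  have := (hK γ hγ).isMarkovKernel
  have habsN : ∀ p ∉ (diagonal X)ᶜ, K γ p (diagonal X)ᶜ = 0 := by
    rintro ⟨x, y⟩ hp
    obtain rfl : x = y := by simpa using hp
    exact (prob_compl_eq_zero_iff measurableSet_diagonal).2 (habs γ hγ x)
  rw [FunctionalAR.ofReal_cost]
  by_cases hxy : (x, y) ∈ (diagonal X)ᶜ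
  · rw [FunctionalAR.cost, FunctionalAR.offDiag_of_ne hxy, one_mul, mul_one, mul_one]
    refine (hdrift γ hγ).lintegral_indicator_pow_le hlam hA hγ hV hV1 hNm habsN ?_
      (FunctionalAR.mul_ceil_mul_le hγ l) hB1 hVB hε0 hε1 (fun p hp => ?_) k (x, y)
    · exact Nat.mul_pos hl (Nat.ceil_pos.2 (one_div_pos.2 hγ.1))
    · exact (hminor γ hγ l hl p.1 p.2).trans
        (ENNReal.ofReal_le_ofReal (sub_le_sub_left (hεΨ γ hγ p hp) 1))
  · rw [lintegral_indicator hNm, setLIntegral_measure_zero _ _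
      (FunctionalAR.pow_apply_eq_zero_of_notMem hNm habsN k hxy)]
    exact zero_le
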